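/- Let $\psi:[0,\infty)\to(0,\infty)$ be a continuous positive function with completely monotone derivative, i.e. $\psi$ is infinitely differentiable on $(0,\infty)$ and $(-1)^n(\psi')^{(n)}(t)\ge 0$ for all $t>0$ and all $n\ge 0$. Let $d,p$ be natural numbers, $0<\lambda\le 2$, let $\sigma_i\in\mathbb{R}$ and $r_i,\nu_i>0$ for $i=1,\dots,p$, and let $\boldsymbol\beta=[\beta_{ij}]_{i,j=1}^p$ be a correlation matrix, i.e. a real symmetric non-negative definite matrix with unit diagonal. For all $i,j=1,\dots,p$ put $$r_{ij}=\Big(\frac{r_i^{-1}+r_j^{-1}}{2}\Big)^{-1},\qquad \nu_{ij}=\frac{\nu_i+\nu_j}{2},\qquad \rho_{ij}=\beta_{ij}\,\frac{\Gamma(\nu_{ij})}{\Gamma(\nu_i)^{1/2}\,\Gamma(\nu_j)^{1/2}}\,\frac{r_{ij}^{\nu_{ij}}}{(r_i^{\nu_i}r_j^{\nu_j})^{1/2}}.$$ Then the multivariate Gneiting--Cauchy space-time model $\mathbf{C}(\mathbf h,u)=[C_{ij}(\mathbf h,u)]_{i,j=1}^p$, $$C_{ij}(\mathbf h,u)=\frac{\sigma_i\sigma_j}{\psi(u^2)^{d/2}}\,\rho_{ij}\left(1+r_{ij}\left\|\frac{\mathbf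 h}{\psi(u^2)^{1/2}}\right\|^{\lambda}\right)^{-\nu_{ij}},\qquad (\mathbf h,u)\in\mathbb{R}^d\times\mathbb{R},$$ where $\|\cdot\|$ is the Euclidean norm, is a valid matrix-valued covariance function on $\mathbb{R}^d\times\mathbb{R}$: for every $n$ and all points $(\mathbf s_1,t_1),\dots,(\mathbf s_n,t_n)\in\mathbb{R}^d\times\mathbb{R}$, the $np\times np$ matrix with $p\times p$ blocks $\mathbf{C}(\mathbf s_a-\mathbf s_b,\,t_a-t_b)$, $a,b=1,\dots,n$, is symmetric and non-negative definite. -/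

import Mathlib

open Set
open scoped ContDiff

/-- Complete monotonicity on the positive real line: `f` is smooth on `(0, ∞)` and
`(-1)ⁿ f⁽ⁿ⁾(t) ≥ 0` for all `n` and all `t > 0`. -/
def CompletelyMonotone (f : ℝ → ℝ) : Prop :=
  ContDiffOn ℝ ∞ f (Ioi 0) ∧ ∀ n : ℕ, ∀ t : ℝ, 0 < t → 0 ≤ (-1) ^ n * iteratedDeriv n f t

/-- `ψ(t)`, `t ≥ 0`, is a (continuous) positive function with a completely monotone derivative on
the positive real line. Differentiability at `0` is not required. -/
structure PositiveWithCMDeriv (ψ : ℝ → ℝ) : Prop where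
  pos : ∀ t : ℝ, 0 ≤ t → 0 < ψ t
  continuousOn : ContinuousOn ψ (Ici 0)
  differentiableOn : DifferentiableOn ℝ ψ (Ioi 0)
  deriv_cm : CompletelyMonotone (deriv ψ)

/-- A correlation matrix: symmetric, non-negative definite, with unit diagonal. -/
def IsCorrelationMatrix {p : ℕ} (β : Matrix (Fin p) (Fin p) ℝ) : Prop :=
  β.PosSemidef ∧ ∀ i, β i i = 1

/-- The `np × np` matrix whose `(a, b)` block is the `p × p` matrix `C (s_a - s_b, t_a - t_b)`. -/
def blockCovMatrix {d p n : ℕ}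
    (C : EuclideanSpace ℝ (Fin d) → ℝ → Matrix (Fin p) (Fin p) ℝ)
    (s : Fin n → EuclideanSpace ℝ (Fin d)) (t : Fin n → ℝ) :
    Matrix (Fin n × Fin p) (Fin n × Fin p) ℝ :=
  Matrix.of fun x y => C (s x.1 - s y.1) (t x.1 - t y.1) x.2 y.2

/-- `C` is a valid (stationary) `p`-variate matrix-valued space-time covariance function on
`ℝᵈ × ℝ`: for all finitely many space-time points the block matrix is symmetric and
non-negative definite. -/
def IsMatrixCovariance {d p : ℕ}
    (C : EuclideanSpace ℝ (Fin d) → ℝ → Matrix (Fin p) (Fin p) ℝ) : Prop :=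
  ∀ (n : ℕ) (s : Fin n → EuclideanSpace ℝ (Fin d)) (t : Fin n → ℝ),
    (blockCovMatrix C s t).PosSemidef

/-- The generalized Cauchy function `(1 + r ‖h‖^lam)^(-ν)`. -/
noncomputable def cauchyFun {d : ℕ} (h : EuclideanSpace ℝ (Fin d)) (r ν lam : ℝ) : ℝ :=
  (1 + r * ‖h‖ ^ lam) ^ (-ν)

/-- The multivariate Gneiting-Cauchy space-time model with given parameter arrays
`ρ = (ρ_ij)`, `r = (r_ij)`, `ν = (ν_ij)`. -/
noncomputable def gneitingCauchy {d p : ℕ} (ψ : ℝ → ℝ) (σ : Fin p → ℝ)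
    (ρ r ν : Matrix (Fin p) (Fin p) ℝ) (lam : ℝ)
    (h : EuclideanSpace ℝ (Fin d)) (u : ℝ) : Matrix (Fin p) (Fin p) ℝ :=
  Matrix.of fun i j =>
    σ i * σ j / ψ (u ^ 2) ^ ((d : ℝ) / 2) * ρ i j *
      cauchyFun ((ψ (u ^ 2) ^ (1 / 2 : ℝ))⁻¹ • h) (r i j) (ν i j) lam

open Filter Topology MeasureTheory Polynomial

/-! ### Completely monotone functions -/

/-! Put a = 1/r_ij and q = (‖h‖²/ψ(u²))^(λ/2). The Gamma integral writes Γ(ν_ij) a^(-ν_ij) (1 +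
q/a)^(-ν_ij) as ∫ v^(ν_ij-1) e^(-(a+q)v) dv over v > 0. Since ν_ij and 1/r_ij are arithmetic means,
v^(ν_ij-1) e^(-av) splits as g_i(v) g_j(v). For each v the integrand is thus a Schur product of β, a
rank-one matrix and the scalar kernel ψ^(-d/2) e^(-vq), and ρ_ij supplies the constants.

For the scalar kernel, e^(-v y^(λ/2)) is completely monotone in y because λ/2 ≤ 1, so Bernstein's
theorem reduces it to Gneiting's kernel (`posSemidef_gneiting`). That one is a Fourier transform of
Gaussians with precision proportional to ψ(u²). It needs e^(-cψ(u²)) to be positive semidefinite,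
which a second use of Bernstein reduces to Gaussians in u.

No representing measure is built: for finitely many points only the dual form
`CompletelyMonotone.sum_mul_nonneg` is needed, and it follows from Hausdorff moments of lattice
samples. -/

lemma CompletelyMonotone.contDiffAt {f : ℝ → ℝ} (hf : CompletelyMonotone f) {t : ℝ} (ht : 0 < t) :
    ContDiffAt ℝ ∞ f t :=
  hf.1.contDiffAt (Ioi_mem_nhds ht)

lemma CompletelyMonotone.nonneg {f : ℝ → ℝ} (hf : CompletelyMonotone f) {t : ℝ} (ht : 0 < t) :
    0 ≤ f t := by
  simpa using hf.2 0 t ht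

lemma CompletelyMonotone.hasDerivAt_iteratedDeriv {f : ℝ → ℝ} (hf : CompletelyMonotone f) (n : ℕ)
    {t : ℝ} (ht : 0 < t) :
    HasDerivAt (iteratedDeriv n f) (iteratedDeriv (n + 1) f t) t := by
  rw [iteratedDeriv_succ]
  have h := ((hf.contDiffAt ht).contDiffWithinAt (s := univ)).differentiableWithinAt_iteratedDerivWithin
    (m := n) (by exact_mod_cast ENat.natCast_lt_top n) (by simp)
  rw [iteratedDerivWithin_univ, differentiableWithinAt_univ] at h
  exact h.hasDerivAt

lemma CompletelyMonotone.antitoneOn_iteratedDeriv {f : ℝ → ℝ} (hf : CompletelyMonotone f) (n : ℕ) :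
    AntitoneOn (fun t => (-1) ^ n * iteratedDeriv n f t) (Ioi 0) := by
  have hd : ∀ t ∈ Ioi (0 : ℝ), HasDerivAt (fun t => (-1) ^ n * iteratedDeriv n f t)
      ((-1) ^ n * iteratedDeriv (n + 1) f t) t := fun t ht =>
    (hf.hasDerivAt_iteratedDeriv n ht).const_mul _
  refine antitoneOn_of_deriv_nonpos (convex_Ioi 0)
    (fun t ht => (hd t ht).continuousAt.continuousWithinAt) ?_ ?_
  · rw [interior_Ioi]
    exact fun t ht => (hd t ht).differentiableAt.differentiableWithinAt
  · rw [interior_Ioi]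
    intro t ht
    rw [(hd t ht).deriv]
    have := hf.2 (n + 1) t ht
    rw [pow_succ] at this
    linarith

/-- The backward difference of a completely monotone function is completely monotone. -/
lemma CompletelyMonotone.sub_shift {f : ℝ → ℝ} (hf : CompletelyMonotone f) {δ : ℝ} (hδ : 0 ≤ δ) :
    CompletelyMonotone (fun t => f t - f (t + δ)) := by
  have hs : ∀ t : ℝ, 0 < t → ContDiffAt ℝ ∞ (fun t => f (t + δ)) t := fun t ht =>
    (hf.contDiffAt (by positivity : 0 < t + δ)).comp t (contDiffAt_id.add contDiffAt_const)
  refine ⟨fun t ht => ((hf.contDiffAt ht).sub (hs t ht)).contDiffWithinAt, fun n t ht => ?_⟩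
  have h := iteratedDeriv_sub (n := n) ((hf.contDiffAt ht).of_le (by exact_mod_cast le_top))
    ((hs t ht).of_le (by exact_mod_cast le_top))
  have e : (fun t => f t - f (t + δ)) = f - fun t => f (t + δ) := rfl
  rw [e, h, iteratedDeriv_comp_add_const]
  have := hf.antitoneOn_iteratedDeriv n (mem_Ioi.2 ht)
    (mem_Ioi.2 (by positivity : 0 < t + δ)) (by linarith)
  simp only at this
  linarith

/-- If `ψ` has a completely monotone derivative, then `exp (-c ψ)` is completely monotone. -/
lemma CompletelyMonotone.exp_neg_mul {ψ : ℝ → ℝ} (hd : DifferentiableOn ℝ ψ (Ioi 0))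
    (h : CompletelyMonotone (deriv ψ)) {c : ℝ} (hc : 0 ≤ c) :
    CompletelyMonotone (fun t => Real.exp (-c * ψ t)) := by
  have hψ : ContDiffOn ℝ ∞ ψ (Ioi 0) :=
    (contDiffOn_infty_iff_deriv_of_isOpen isOpen_Ioi).2 ⟨hd, h.1⟩
  have hg : ContDiffOn ℝ ∞ (fun t => Real.exp (-c * ψ t)) (Ioi 0) :=
    (contDiffOn_const.mul hψ).exp
  have hga : ∀ t : ℝ, 0 < t → ContDiffAt ℝ ∞ (fun t => Real.exp (-c * ψ t)) t := fun t ht =>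
    hg.contDiffAt (Ioi_mem_nhds ht)
  refine ⟨hg, fun n => ?_⟩
  -- The derivative is -cψ' e^(-cψ), so by Leibniz order n + 1 involves only orders at most n of
  -- e^(-cψ), and the signs multiply.
  induction n using Nat.strong_induction_on with
  | _ n ih =>
    intro t ht
    rcases n with _ | n
    · simpa using (Real.exp_pos _).le
    · have he : deriv (fun t => Real.exp (-c * ψ t)) =ᶠ[𝓝 t]
          fun x => (-c) * (deriv ψ * fun t => Real.exp (-c * ψ t)) x := by
        filter_upwards [Ioi_mem_nhds ht] with x hx
        have hx' := ((hd.hasDerivAt (Ioi_mem_nhds hx)).const_mul (-c)).exp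
        rw [hx'.deriv]
        simp only [Pi.mul_apply]
        ring
      rw [iteratedDeriv_succ', he.iteratedDeriv_eq, iteratedDeriv_const_mul_field,
        iteratedDeriv_mul ((h.contDiffAt ht).of_le (by exact_mod_cast le_top))
          ((hga t ht).of_le (by exact_mod_cast le_top)), Finset.mul_sum, Finset.mul_sum]
      refine Finset.sum_nonneg fun i hi => ?_
      have hi' : i ≤ n := Nat.lt_succ_iff.1 (Finset.mem_range.1 hi)
      have h1 := h.2 i t ht
      have h2 := ih (n - i) (by omega) t ht
      have h3 : ((-1 : ℝ)) ^ (n + 1) = -((-1) ^ i * (-1) ^ (n - i)) := by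
        rw [← pow_add, Nat.add_sub_cancel' hi', pow_succ]; ring
      have h4 : 0 ≤ c * (n.choose i : ℝ) := by positivity
      have := mul_nonneg h4 (mul_nonneg h1 h2)
      rw [h3]
      linarith

/-- `t ^ a` has a completely monotone derivative for `0 ≤ a ≤ 1`. -/
lemma completelyMonotone_deriv_rpow {a : ℝ} (ha : 0 ≤ a) (ha' : a ≤ 1) :
    CompletelyMonotone (deriv fun t : ℝ => t ^ a) := by
  have hc : ContDiffOn ℝ ∞ (fun t : ℝ => t ^ a) (Ioi 0) := fun t ht =>
    (Real.contDiffAt_rpow_const_of_ne (ne_of_gt ht)).contDiffWithinAt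
  refine ⟨((contDiffOn_infty_iff_deriv_of_isOpen isOpen_Ioi).1 hc).2, fun n t ht => ?_⟩
  -- Each further factor a - (n + 1) is nonpositive because a ≤ 1.
  have key : ∀ n : ℕ, 0 ≤ (-1) ^ n * (descPochhammer ℝ (n + 1)).eval a := by
    intro n
    induction n with
    | zero => simpa using ha
    | succ n ih =>
      rw [descPochhammer_succ_right, eval_mul]
      simp only [eval_sub, eval_X, eval_natCast]
      have : 0 ≤ ((n + 1 : ℕ) : ℝ) - a := by push_cast; linarith [n.cast_nonneg (α := ℝ)]
      have := mul_nonneg ih this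
      rw [pow_succ]
      linarith
  rw [← iteratedDeriv_succ', iteratedDeriv_eq_iterate, Real.iter_deriv_rpow_const, ← mul_assoc]
  exact mul_nonneg (key n) (Real.rpow_nonneg ht.le _)

/-! ### Hausdorff moment functionals -/

/-- The linear functional on real polynomials with prescribed moments `X ^ k ↦ a k`. -/
noncomputable def momentFunctional (a : ℕ → ℝ) : ℝ[X] →ₗ[ℝ] ℝ :=
  (Polynomial.basisMonomials ℝ).constr ℝ a

lemma momentFunctional_X_pow (a : ℕ → ℝ) (k : ℕ) : momentFunctional a (X ^ k) = a k := by
  have h : (X ^ k : ℝ[X]) = Polynomial.basisMonomials ℝ k := by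
    simp [coe_basisMonomials, monomial_one_right_eq_X_pow]
  rw [h, momentFunctional, Module.Basis.constr_basis]

/-- Turns powers of 1 - X into iterated differences of the samples, which `sub_shift` controls. -/
lemma momentFunctional_mul_one_sub_X (a : ℕ → ℝ) (p : ℝ[X]) :
    momentFunctional a (p * (1 - X)) = momentFunctional (fun k => a k - a (k + 1)) p := by
  induction p using Polynomial.induction_on' with
  | add p q hp hq => rw [add_mul, map_add, map_add, hp, hq]
  | monomial n c =>
    rw [← C_mul_X_pow_eq_monomial, ← smul_eq_C_mul, smul_mul_assoc, map_smul, map_smul, mul_sub,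
      mul_one, ← pow_succ, map_sub]
    simp only [momentFunctional_X_pow]

/-- The moment functional of a completely monotone function sampled on a lattice is nonnegative on
the Bernstein polynomials. -/
lemma CompletelyMonotone.momentFunctional_nonneg {f : ℝ → ℝ} (hf : CompletelyMonotone f)
    {ε δ : ℝ} (hε : 0 < ε) (hδ : 0 ≤ δ) (k m : ℕ) :
    0 ≤ momentFunctional (fun k => f (ε + δ * k)) (X ^ k * (1 - X) ^ m) := by
  induction m generalizing f with
  | zero =>
    rw [pow_zero, mul_one, momentFunctional_X_pow]
    exact hf.nonneg (by positivity)
  | succ m ih =>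
    rw [pow_succ, ← mul_assoc, momentFunctional_mul_one_sub_X]
    convert ih (hf.sub_shift hδ) using 5 with j
    push_cast
    ring_nf

/-- Expand X^k (X + (1 - X))^(n-k); the terms j < k have zero falling factorial. The other
coefficients are nearly (j/n)^k, so moments resemble sums over the nodes j/n. -/
lemma X_pow_eq_sum_bernstein {k n : ℕ} (hk : k ≤ n) :
    (X ^ k : ℝ[X]) = ∑ j ∈ Finset.range (n + 1),
      (n.choose j * ((j.descFactorial k : ℝ) / n.descFactorial k)) • (X ^ j * (1 - X) ^ (n - j)) := by
  obtain ⟨m, rfl⟩ := Nat.exists_eq_add_of_le hk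
  rw [add_assoc, Finset.sum_range_add, Finset.sum_eq_zero, zero_add]
  · have h1 : (X ^ k : ℝ[X]) = X ^ k * (X + (1 - X)) ^ m := by simp
    rw [h1, add_pow, Finset.mul_sum]
    refine Finset.sum_congr rfl fun i hi => ?_
    have hi' : i ≤ m := Nat.lt_succ_iff.1 (Finset.mem_range.1 hi)
    have hc : ((k + m).choose (k + i) * (((k + i).descFactorial k : ℝ) / (k + m).descFactorial k))
        = m.choose i := by
      have h0 : ((k + m).descFactorial k : ℝ) ≠ 0 := by
        exact_mod_cast (Nat.descFactorial_pos.2 hk).ne'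
      rw [← mul_div_assoc, div_eq_iff h0]
      have := Nat.choose_mul (n := k + m) (k := k + i) (s := k) (by omega)
      rw [Nat.add_sub_cancel_left, Nat.add_sub_cancel_left] at this
      rw [Nat.descFactorial_eq_factorial_mul_choose, Nat.descFactorial_eq_factorial_mul_choose]
      have h2 : ((k + m).choose (k + i) : ℝ) * (k + i).choose k = (k + m).choose k * m.choose i := by
        exact_mod_cast this
      push_cast
      linear_combination (k.factorial : ℝ) * h2
    rw [hc, show k + m - (k + i) = m - i by omega, smul_eq_C_mul, pow_add, map_natCast]
    ring
  · intro j hj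
    rw [Nat.descFactorial_of_lt (Finset.mem_range.1 hj)]
    simp

/-- The ratio is a product of k factors (j-i)/(n-i), each within i/n of j/n, and the errors add up.
-/
lemma abs_descFactorial_div_sub_pow_le {j k n : ℕ} (hj : j ≤ n) (hk : k ≤ n) :
    |(j.descFactorial k : ℝ) / n.descFactorial k - ((j : ℝ) / n) ^ k| ≤ (k : ℝ) ^ 2 / n := by
  induction k with
  | zero => simp
  | succ k ih =>
    have ih := ih (by omega)
    have hn : (0 : ℝ) < n := by exact_mod_cast (by omega : 0 < n)
    have hnk : (0 : ℝ) < ((n - k : ℕ) : ℝ) := by exact_mod_cast (by omega : 0 < n - k)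
    rw [Nat.descFactorial_succ, Nat.descFactorial_succ, pow_succ]
    push_cast
    set u := (j.descFactorial k : ℝ) / n.descFactorial k
    set v := (j : ℝ) / n with hv
    set w := ((j - k : ℕ) : ℝ) / ((n - k : ℕ) : ℝ) with hw
    have hw0 : 0 ≤ w := by positivity
    have hw1 : w ≤ 1 := by
      rw [hw, div_le_one hnk]; exact_mod_cast Nat.sub_le_sub_right hj k
    have hv0 : 0 ≤ v := by positivity
    have hv1 : v ≤ 1 := by rw [hv, div_le_one hn]; exact_mod_cast hj
    have hvw : |w - v| ≤ k / n := by
      rcases le_total j k with h | h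
      · rw [hw, Nat.sub_eq_zero_of_le h, hv]
        simp only [Nat.cast_zero, zero_div, zero_sub, abs_neg]
        rw [abs_of_nonneg (by positivity)]
        gcongr
      · have hkn : (k : ℝ) ≤ n := by exact_mod_cast (by omega : k ≤ n)
        have hjn : (j : ℝ) ≤ n := by exact_mod_cast hj
        have hkj : (k : ℝ) ≤ j := by exact_mod_cast h
        rw [Nat.cast_sub (by omega)] at hnk
        rw [hw, hv, Nat.cast_sub h, Nat.cast_sub (by omega), div_sub_div _ _ hnk.ne' hn.ne',
          abs_le, le_div_iff₀ (by positivity), div_le_iff₀ (by positivity)]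
        have e : (k : ℝ) / n * (((n : ℝ) - k) * n) = k * (n - k) := by field_simp
        have hk0 : (0 : ℝ) ≤ k := k.cast_nonneg
        constructor
        · rw [neg_mul, e]; nlinarith
        · rw [e]; nlinarith
    have e1 : ((j - k : ℕ) : ℝ) * (j.descFactorial k) / (((n - k : ℕ) : ℝ) * n.descFactorial k)
        - v ^ k * v = w * (u - v ^ k) + v ^ k * (w - v) := by
      rw [mul_div_mul_comm]; ring
    rw [e1]
    calc _ ≤ |w * (u - v ^ k)| + |v ^ k * (w - v)| := abs_add_le _ _
      _ ≤ 1 * ((k : ℝ) ^ 2 / n) + 1 * (k / n) := by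
        rw [abs_mul, abs_mul, abs_of_nonneg hw0, abs_of_nonneg (pow_nonneg hv0 k)]
        gcongr
        exact pow_le_one₀ hv0 hv1
      _ ≤ _ := by
        rw [one_mul, one_mul, ← add_div]
        gcongr
        nlinarith [k.cast_nonneg (α := ℝ)]

/-- A linear combination of Hausdorff moments is bounded below by any lower bound on `[0, 1]` of the
corresponding polynomial, times the total mass. -/
theorem neg_mul_le_sum_of_momentFunctional_nonneg {a : ℕ → ℝ}
    (ha : ∀ k m, 0 ≤ momentFunctional a (X ^ k * (1 - X) ^ m)) {ι : Type*} [Fintype ι]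
    (k : ι → ℕ) (c : ι → ℝ) {η : ℝ}
    (h : ∀ q ∈ Icc (0 : ℝ) 1, -η ≤ ∑ i, c i * q ^ k i) :
    -η * a 0 ≤ ∑ i, c i * a (k i) := by
  set E : ℝ := ∑ i, |c i| * (k i : ℝ) ^ 2 with hE
  have hlim : Tendsto (fun n : ℕ => -(η + E / n) * a 0) atTop (𝓝 (-(η + 0) * a 0)) :=
    ((tendsto_const_nhds.add (tendsto_const_div_atTop_nhds_zero_nat E)).neg).mul_const _
  rw [add_zero] at hlim
  refine le_of_tendsto hlim ?_
  filter_upwards [eventually_ge_atTop (∑ i, k i)] with n hn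
  have hk : ∀ i, k i ≤ n := fun i =>
    (Finset.single_le_sum (fun i _ => Nat.zero_le (k i)) (Finset.mem_univ i)).trans hn
  -- Nonnegative weights at the nodes j/n, of total mass a 0.
  set w : ℕ → ℝ := fun j => n.choose j * momentFunctional a (X ^ j * (1 - X) ^ (n - j)) with hw
  have hw0 : ∀ j, 0 ≤ w j := fun j => mul_nonneg (by positivity) (ha _ _)
  have hrep : ∀ l ≤ n, a l = ∑ j ∈ Finset.range (n + 1),
      w j * ((j.descFactorial l : ℝ) / n.descFactorial l) := by
    intro l hl
    rw [← momentFunctional_X_pow a l, X_pow_eq_sum_bernstein hl, map_sum]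
    refine Finset.sum_congr rfl fun j _ => ?_
    rw [map_smul, smul_eq_mul, hw]
    ring
  have h0 : a 0 = ∑ j ∈ Finset.range (n + 1), w j := by
    rw [hrep 0 (Nat.zero_le n)]; simp
  have hsum : ∑ i, c i * a (k i) = ∑ j ∈ Finset.range (n + 1),
      w j * ∑ i, c i * ((j.descFactorial (k i) : ℝ) / n.descFactorial (k i)) := by
    simp only [Finset.mul_sum]
    rw [Finset.sum_comm]
    refine Finset.sum_congr rfl fun i _ => ?_
    rw [hrep _ (hk i), Finset.mul_sum]
    exact Finset.sum_congr rfl fun j _ => by ring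
  rw [hsum, h0, Finset.mul_sum]
  refine Finset.sum_le_sum fun j hj => ?_
  rw [mul_comm]
  refine mul_le_mul_of_nonneg_left ?_ (hw0 j)
  have hjn : j ≤ n := Nat.lt_succ_iff.1 (Finset.mem_range.1 hj)
  have hq := h ((j : ℝ) / n) ⟨by positivity, div_le_one_of_le₀ (by exact_mod_cast hjn) (by positivity)⟩
  have hdiff : ∑ i, c i * ((j : ℝ) / n) ^ k i
      - ∑ i, c i * ((j.descFactorial (k i) : ℝ) / n.descFactorial (k i)) ≤ E / n := by
    rw [← Finset.sum_sub_distrib, hE, Finset.sum_div]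
    refine Finset.sum_le_sum fun i _ => ?_
    rw [← mul_sub, mul_div_assoc]
    refine (le_abs_self _).trans ?_
    rw [abs_mul, abs_sub_comm]
    exact mul_le_mul_of_nonneg_left (abs_descFactorial_div_sub_pow_le hjn (hk i)) (abs_nonneg _)
  linarith

/-- **Bernstein's theorem**, dual form: a linear relation `0 ≤ ∑ cᵢ f(xᵢ)` that holds for all
decaying exponentials holds for all completely monotone functions continuous at `0`. -/
theorem CompletelyMonotone.sum_mul_nonneg {f : ℝ → ℝ} (hf : CompletelyMonotone f)
    (hcont : ContinuousOn f (Ici 0)) {ι : Type*} [Fintype ι] {x : ι → ℝ} (hx : ∀ i, 0 ≤ x i)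
    (c : ι → ℝ) (h : ∀ s : ℝ, 0 < s → 0 ≤ ∑ i, c i * Real.exp (-s * x i)) :
    0 ≤ ∑ i, c i * f (x i) := by
  -- B/(m+1) bounds the error of rounding each x i up to the lattice of mesh 1/(m+1). Samples are
  -- also shifted by 1/(m+1), as complete monotonicity holds only on the open half-line.
  set B : ℝ := ∑ i, |c i| * (x i)⁻¹ with hB
  have hinv : Tendsto (fun m : ℕ => 1 / ((m : ℝ) + 1)) atTop (𝓝 0) :=
    tendsto_one_div_add_atTop_nhds_zero_nat
  have hmem : ∀ m : ℕ, (0 : ℝ) < 1 / ((m : ℝ) + 1) := fun m => by positivity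
  have hf0 : Tendsto (fun m : ℕ => f (1 / ((m : ℝ) + 1))) atTop (𝓝 (f 0)) :=
    (hcont 0 self_mem_Ici).tendsto.comp (tendsto_nhdsWithin_iff.2
      ⟨hinv, Eventually.of_forall fun m => (hmem m).le⟩)
  have hfx : ∀ i, Tendsto (fun m : ℕ => f (1 / ((m : ℝ) + 1) +
      1 / ((m : ℝ) + 1) * (⌈((m : ℝ) + 1) * x i⌉₊ : ℕ))) atTop (𝓝 (f (x i))) := by
    intro i
    refine (hcont (x i) (hx i)).tendsto.comp (tendsto_nhdsWithin_iff.2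
      ⟨?_, Eventually.of_forall fun m => mem_Ici.2 (by positivity)⟩)
    have hu : Tendsto (fun m : ℕ => x i + 2 * (1 / ((m : ℝ) + 1))) atTop (𝓝 (x i)) := by
      simpa using tendsto_const_nhds.add (hinv.const_mul 2)
    refine tendsto_of_tendsto_of_tendsto_of_le_of_le tendsto_const_nhds hu (fun m => ?_) fun m => ?_
    · have := Nat.le_ceil (((m : ℝ) + 1) * x i)
      have h2 : x i ≤ 1 / ((m : ℝ) + 1) * (⌈((m : ℝ) + 1) * x i⌉₊ : ℕ) := by
        rw [one_div_mul_eq_div, le_div_iff₀ (by positivity)]; linarith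
      have := hmem m
      simp only
      linarith
    · have := Nat.ceil_lt_add_one (mul_nonneg (by positivity : 0 ≤ (m : ℝ) + 1) (hx i))
      have h2 : 1 / ((m : ℝ) + 1) * (⌈((m : ℝ) + 1) * x i⌉₊ : ℕ) ≤ x i + 1 / ((m : ℝ) + 1) := by
        rw [one_div_mul_eq_div, div_le_iff₀ (by positivity)]
        have e : (x i + 1 / ((m : ℝ) + 1)) * ((m : ℝ) + 1) = ((m : ℝ) + 1) * x i + 1 := by
          field_simp
        linarith
      simp only
      linarith
  have hL : Tendsto (fun m : ℕ => -(B * (1 / ((m : ℝ) + 1))) * f (1 / ((m : ℝ) + 1))) atTop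
      (𝓝 (-(B * 0) * f 0)) := ((hinv.const_mul B).neg).mul hf0
  have hR := tendsto_finsetSum Finset.univ fun i _ => (hfx i).const_mul (c i)
  rw [mul_zero, neg_zero, zero_mul] at hL
  refine le_of_tendsto_of_tendsto' hL hR fun m => ?_
  have hm : (0 : ℝ) < (m : ℝ) + 1 := by positivity
  have key := neg_mul_le_sum_of_momentFunctional_nonneg
    (hf.momentFunctional_nonneg (hmem m) (hmem m).le)
    (fun i => ⌈((m : ℝ) + 1) * x i⌉₊) c (η := B * (1 / ((m : ℝ) + 1))) ?_
  · simpa using key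
  have hclosed : IsClosed {q : ℝ | -(B * (1 / ((m : ℝ) + 1))) ≤
      ∑ i, c i * q ^ ⌈((m : ℝ) + 1) * x i⌉₊} := isClosed_le continuous_const (by fun_prop)
  rw [← closure_Ioo zero_ne_one]
  refine fun q hq => hclosed.closure_subset_iff.2 (fun q hq => ?_) hq
  obtain ⟨s, rfl⟩ : ∃ s, q = Real.exp (-s) := ⟨-Real.log q, by rw [neg_neg, Real.exp_log hq.1]⟩
  have hs : 0 < s := by
    have := hq.2
    rw [Real.exp_lt_one_iff] at this
    linarith
  have hh := h (s * (m + 1)) (by positivity)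
  rw [mem_ofPred_eq]
  have hdiff : ∑ i, c i * Real.exp (-(s * (m + 1)) * x i)
      - ∑ i, c i * Real.exp (-s) ^ ⌈((m : ℝ) + 1) * x i⌉₊ ≤ B * (1 / ((m : ℝ) + 1)) := by
    rw [← Finset.sum_sub_distrib, hB, Finset.sum_mul]
    refine Finset.sum_le_sum fun i _ => ?_
    rw [← mul_sub, mul_assoc]
    refine (le_abs_self _).trans ?_
    rw [abs_mul]
    refine mul_le_mul_of_nonneg_left ?_ (abs_nonneg _)
    rw [← Real.exp_nat_mul]
    -- At x i = 0 rounding is exact, matching the convention 0⁻¹ = 0 in B.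
    rcases (hx i).eq_or_lt with h0 | h0
    · rw [← h0]; simp
    set k : ℝ := ((⌈((m : ℝ) + 1) * x i⌉₊ : ℕ) : ℝ)
    have hk1 : ((m : ℝ) + 1) * x i ≤ k := Nat.le_ceil _
    have hk2 : k < ((m : ℝ) + 1) * x i + 1 := Nat.ceil_lt_add_one (by positivity)
    set y := ((m : ℝ) + 1) * x i with hy
    have hy0 : 0 < y := by positivity
    have e1 : Real.exp (-(s * (m + 1)) * x i) = Real.exp (-(s * y)) := by rw [hy]; ring_nf
    have e2 : Real.exp (k * -s) = Real.exp (-(s * y)) * Real.exp (-(s * (k - y))) := by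
      rw [← Real.exp_add]; ring_nf
    have e3 : (x i)⁻¹ * (1 / ((m : ℝ) + 1)) = y⁻¹ := by rw [hy]; field_simp
    rw [e1, e2, e3]
    -- Rounding moves the exponential by at most s e^(-sy), which is at most 1/y uniformly in s.
    have hA : Real.exp (-(s * y)) * (s * y) ≤ 1 := by
      rw [Real.exp_neg, inv_mul_le_iff₀ (Real.exp_pos _), mul_one]
      linarith [Real.add_one_le_exp (s * y)]
    have hb1 : Real.exp (-(s * (k - y))) ≤ 1 := Real.exp_le_one_iff.2 (by nlinarith)
    have hb2 : 1 - Real.exp (-(s * (k - y))) ≤ s := by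
      have := Real.add_one_le_exp (-(s * (k - y)))
      nlinarith
    have hp := Real.exp_pos (-(s * y))
    rw [abs_of_nonneg (by nlinarith), inv_eq_one_div, le_div_iff₀ hy0]
    calc _ = Real.exp (-(s * y)) * ((1 - Real.exp (-(s * (k - y)))) * y) := by ring
      _ ≤ Real.exp (-(s * y)) * (s * y) := by gcongr
      _ ≤ 1 := hA
  linarith

/-! ### Positive semidefinite kernels -/

/-- A single sum over pairs is the form to which `sum_mul_nonneg` applies. -/
lemma posSemidef_iff_sum_prod {n : Type*} [Fintype n] {M : Matrix n n ℝ} :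
    M.PosSemidef ↔
      (∀ a b, M b a = M a b) ∧ ∀ c : n → ℝ, 0 ≤ ∑ i : n × n, c i.1 * c i.2 * M i.1 i.2 := by
  have e : ∀ c : n → ℝ, star c ⬝ᵥ M.mulVec c = ∑ i : n × n, c i.1 * c i.2 * M i.1 i.2 := by
    intro c
    rw [Fintype.sum_prod_type]
    simp only [dotProduct, Matrix.mulVec, Finset.mul_sum, star_trivial]
    exact Finset.sum_congr rfl fun a _ => Finset.sum_congr rfl fun b _ => by ring
  rw [Matrix.posSemidef_iff_dotProduct_mulVec]
  refine and_congr ?_ (forall_congr' fun c => by rw [e])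
  rw [Matrix.IsHermitian.ext_iff]
  simp only [star_trivial]

lemma posSemidef_mul_self {n : Type*} [Fintype n] (g : n → ℝ) :
    (Matrix.of fun a b => g a * g b).PosSemidef := by
  simpa [Matrix.vecMulVec, funext_iff] using Matrix.posSemidef_vecMulVec_self_star g

lemma posSemidef_mul {n : Type*} {A B : Matrix n n ℝ} (hA : A.PosSemidef) (hB : B.PosSemidef) :
    (Matrix.of fun a b => A a b * B a b).PosSemidef :=
  hA.hadamard hB

lemma posSemidef_integral {α : Type*} [MeasurableSpace α] {μ : Measure α} {n : Type*} [Fintype n]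
    {M : α → Matrix n n ℝ} (hint : ∀ a b, Integrable (fun v => M v a b) μ)
    (h : ∀ᵐ v ∂μ, (M v).PosSemidef) :
    (Matrix.of fun a b => ∫ v, M v a b ∂μ).PosSemidef := by
  rw [posSemidef_iff_sum_prod]
  refine ⟨fun a b => integral_congr_ae ?_, fun c => ?_⟩
  · filter_upwards [h] with v hv
    exact (posSemidef_iff_sum_prod.1 hv).1 a b
  · simp only [Matrix.of_apply, ← integral_const_mul]
    rw [← integral_finsetSum _ fun i _ => (hint i.1 i.2).const_mul _]
    refine integral_nonneg_of_ae ?_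
    filter_upwards [h] with v hv
    exact (posSemidef_iff_sum_prod.1 hv).2 c

/-- A weighted kernel that is positive semidefinite for all decaying exponentials is so for all
completely monotone functions continuous at `0`. -/
lemma CompletelyMonotone.posSemidef {f : ℝ → ℝ} (hf : CompletelyMonotone f)
    (hcont : ContinuousOn f (Ici 0)) {n : Type*} [Fintype n] {W x : n → n → ℝ}
    (hW : ∀ a b, W b a = W a b) (hxs : ∀ a b, x b a = x a b) (hx : ∀ a b, 0 ≤ x a b)
    (h : ∀ s : ℝ, 0 < s → (Matrix.of fun a b => W a b * Real.exp (-s * x a b)).PosSemidef) :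
    (Matrix.of fun a b => W a b * f (x a b)).PosSemidef := by
  rw [posSemidef_iff_sum_prod]
  refine ⟨fun a b => by simp only [Matrix.of_apply, hW a b, hxs a b], fun c => ?_⟩
  simp only [Matrix.of_apply, ← mul_assoc]
  refine hf.sum_mul_nonneg hcont (x := fun i : n × n => x i.1 i.2) (fun i => hx i.1 i.2)
    (fun i => c i.1 * c i.2 * W i.1 i.2) fun s hs => ?_
  simpa only [Matrix.of_apply, ← mul_assoc] using (posSemidef_iff_sum_prod.1 (h s hs)).2 c

section Gaussian

variable {V : Type*} [NormedAddCommGroup V] [InnerProductSpace ℝ V] [FiniteDimensional ℝ V]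
  [MeasurableSpace V] [BorelSpace V]

lemma integrable_cos_inner_mul_gaussian {b : ℝ} (hb : 0 < b) (w : V) :
    Integrable fun v : V => Real.cos (inner ℝ w v) * Real.exp (-b * ‖v‖ ^ 2) := by
  have h := (GaussianFourier.integrable_cexp_neg_mul_sq_norm_add
    (show 0 < (b : ℂ).re from hb) Complex.I w).re
  refine h.congr (Eventually.of_forall fun v => ?_)
  simp [Complex.exp_re, mul_comm, ← Complex.ofReal_pow, ← Complex.ofReal_mul]

lemma integral_cos_inner_mul_gaussian {b : ℝ} (hb : 0 < b) (w : V) :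
    ∫ v : V, Real.cos (inner ℝ w v) * Real.exp (-b * ‖v‖ ^ 2) =
      (Real.pi / b) ^ (Module.finrank ℝ V / 2 : ℝ) * Real.exp (-‖w‖ ^ 2 / (4 * b)) := by
  have hi := GaussianFourier.integrable_cexp_neg_mul_sq_norm_add
    (show 0 < (b : ℂ).re from hb) Complex.I w
  have h := GaussianFourier.integral_cexp_neg_mul_sq_norm_add
    (show 0 < (b : ℂ).re from hb) Complex.I w
  have h2 := congrArg Complex.re h
  have h3 : ((∫ v : V, Complex.exp (-b * ‖v‖ ^ 2 + Complex.I * inner ℝ w v)).re : ℝ) =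
      ∫ v : V, (Complex.exp (-b * ‖v‖ ^ 2 + Complex.I * inner ℝ w v)).re :=
    (integral_re hi).symm
  rw [h3] at h2
  have h4 : ((Real.pi : ℂ) / b) ^ (Module.finrank ℝ V / 2 : ℂ) *
      Complex.exp (Complex.I ^ 2 * ‖w‖ ^ 2 / (4 * b)) =
      (((Real.pi / b) ^ (Module.finrank ℝ V / 2 : ℝ) * Real.exp (-‖w‖ ^ 2 / (4 * b)) : ℝ) : ℂ) := by
    rw [Complex.ofReal_mul, Complex.ofReal_cpow (by positivity)]
    push_cast
    rw [Complex.I_sq, neg_one_mul]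
  rw [h4, Complex.ofReal_re] at h2
  rw [← h2]
  refine integral_congr_ae (Eventually.of_forall fun v => ?_)
  simp [Complex.exp_re, mul_comm, ← Complex.ofReal_pow, ← Complex.ofReal_mul]

/-- Gaussian kernels with variable precision: if `exp (-r bₐ_b)` is positive semidefinite for all
`r ≥ 0`, then so is the matrix of Fourier transforms of `exp (-bₐ_b ‖·‖²)`. -/
lemma posSemidef_gaussian {n : Type*} [Fintype n] (x : n → V) {b : n → n → ℝ}
    (hb : ∀ i j, 0 < b i j)
    (h : ∀ r : ℝ, 0 ≤ r → (Matrix.of fun i j => Real.exp (-b i j * r)).PosSemidef) :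
    (Matrix.of fun i j => (Real.pi / b i j) ^ (Module.finrank ℝ V / 2 : ℝ) *
      Real.exp (-‖x i - x j‖ ^ 2 / (4 * b i j))).PosSemidef := by
  simp only [← integral_cos_inner_mul_gaussian (hb _ _)]
  refine posSemidef_integral (M := fun v : V => Matrix.of fun i j =>
    Real.cos (inner ℝ (x i - x j) v) * Real.exp (-b i j * ‖v‖ ^ 2))
    (fun i j => integrable_cos_inner_mul_gaussian (hb i j) _) (Eventually.of_forall fun v => ?_)
  -- The cosine of a difference is a sum of two rank-one kernels.
  have h1 := posSemidef_mul ((posSemidef_mul_self fun i => Real.cos (inner ℝ (x i) v)).add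
    (posSemidef_mul_self fun i => Real.sin (inner ℝ (x i) v))) (h (‖v‖ ^ 2) (sq_nonneg _))
  convert h1 using 1
  ext i j
  simp [inner_sub_left, Real.cos_sub]

lemma posSemidef_exp_neg_mul_sq_norm {n : Type*} [Fintype n] (x : n → V) {s : ℝ} (hs : 0 < s) :
    (Matrix.of fun i j => Real.exp (-s * ‖x i - x j‖ ^ 2)).PosSemidef := by
  have h := posSemidef_gaussian x (b := fun _ _ => 1 / (4 * s)) (fun _ _ => by positivity)
    (fun r _ => by
      convert posSemidef_mul_self (fun _ : n => Real.exp (-(1 / (4 * s)) * (r / 2))) using 4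
      rw [← Real.exp_add]; ring_nf)
  set C : ℝ := (Real.pi / (1 / (4 * s))) ^ (Module.finrank ℝ V / 2 : ℝ) with hC
  have hCpos : 0 < C := by positivity
  convert h.smul (inv_nonneg.2 hCpos.le) using 1
  ext i j
  simp only [Matrix.of_apply, Matrix.smul_apply, smul_eq_mul]
  rw [inv_mul_cancel_left₀ hCpos.ne']
  congr 1
  field_simp

end Gaussian

/-- By Bernstein applied to e^(-cψ), it suffices to treat e^(-su²). -/
lemma PositiveWithCMDeriv.posSemidef_exp {ψ : ℝ → ℝ} (hψ : PositiveWithCMDeriv ψ) {n : Type*}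
    [Fintype n] (t : n → ℝ) {c : ℝ} (hc : 0 ≤ c) :
    (Matrix.of fun a b => Real.exp (-c * ψ ((t a - t b) ^ 2))).PosSemidef := by
  have h := (CompletelyMonotone.exp_neg_mul hψ.differentiableOn hψ.deriv_cm hc).posSemidef
    (continuousOn_const.mul hψ.continuousOn).rexp
    (W := fun _ _ => 1) (x := fun a b => (t a - t b) ^ 2) (fun _ _ => rfl)
    (fun a b => by ring) (fun a b => sq_nonneg _) fun s hs => by
      simpa only [one_mul, Real.norm_eq_abs, sq_abs] using posSemidef_exp_neg_mul_sq_norm t hs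
  simpa only [one_mul] using h

/-- The space-time kernel `ψ(u²)^(-d/2) exp (-s ‖h‖² / ψ(u²))` of Gneiting. -/
lemma PositiveWithCMDeriv.posSemidef_gneiting {ψ : ℝ → ℝ} (hψ : PositiveWithCMDeriv ψ) {d : ℕ}
    {n : Type*} [Fintype n] (x : n → EuclideanSpace ℝ (Fin d)) (t : n → ℝ) {s : ℝ} (hs : 0 < s) :
    (Matrix.of fun a b => (ψ ((t a - t b) ^ 2) ^ ((d : ℝ) / 2))⁻¹ *
      Real.exp (-s * (‖x a - x b‖ ^ 2 / ψ ((t a - t b) ^ 2)))).PosSemidef := by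
  have hpos : ∀ a b, 0 < ψ ((t a - t b) ^ 2) := fun a b => hψ.pos _ (sq_nonneg _)
  -- This precision makes ‖h‖²/(4b) equal s‖h‖²/ψ, and (π/b)^(d/2) produces ψ^(-d/2).
  have h := posSemidef_gaussian x (b := fun a b => ψ ((t a - t b) ^ 2) / (4 * s))
    (fun a b => div_pos (hpos a b) (by positivity)) (fun r hr => by
      convert hψ.posSemidef_exp t (c := r / (4 * s)) (by positivity) using 4
      ring_nf)
  have hC : (0 : ℝ) < (Real.pi * (4 * s)) ^ ((d : ℝ) / 2) := by positivity
  convert h.smul (inv_nonneg.2 hC.le) using 1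
  ext a b
  have := hpos a b
  simp only [Matrix.of_apply, Matrix.smul_apply, smul_eq_mul, finrank_euclideanSpace_fin]
  rw [div_div_eq_mul_div, Real.div_rpow (by positivity) this.le,
    div_eq_mul_inv (_ ^ ((d : ℝ) / 2)), mul_assoc, inv_mul_cancel_left₀ hC.ne']
  congr 2
  field_simp

/-- The kernel `ψ(u²)^(-d/2) exp (-v (‖h‖² / ψ(u²)) ^ α)`. -/
lemma PositiveWithCMDeriv.posSemidef_gneiting_stable {ψ : ℝ → ℝ} (hψ : PositiveWithCMDeriv ψ)
    {d : ℕ} {n : Type*} [Fintype n] (x : n → EuclideanSpace ℝ (Fin d)) (t : n → ℝ) {v α : ℝ}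
    (hv : 0 ≤ v) (hα : 0 ≤ α) (hα' : α ≤ 1) :
    (Matrix.of fun a b => (ψ ((t a - t b) ^ 2) ^ ((d : ℝ) / 2))⁻¹ *
      Real.exp (-v * (‖x a - x b‖ ^ 2 / ψ ((t a - t b) ^ 2)) ^ α)).PosSemidef := by
  have hsq : ∀ a b, (t b - t a) ^ 2 = (t a - t b) ^ 2 := fun a b => by ring
  have hd : DifferentiableOn ℝ (fun y : ℝ => y ^ α) (Ioi 0) := fun y hy =>
    (Real.differentiableAt_rpow_const_of_ne α (ne_of_gt hy)).differentiableWithinAt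
  exact (CompletelyMonotone.exp_neg_mul hd (completelyMonotone_deriv_rpow hα hα') hv).posSemidef
    (continuousOn_const.mul (continuousOn_id.rpow_const fun _ _ => Or.inr hα)).rexp
    (W := fun a b => (ψ ((t a - t b) ^ 2) ^ ((d : ℝ) / 2))⁻¹)
    (x := fun a b => ‖x a - x b‖ ^ 2 / ψ ((t a - t b) ^ 2))
    (fun a b => by rw [hsq]) (fun a b => by rw [hsq, norm_sub_rev])
    (fun a b => div_nonneg (sq_nonneg _) (hψ.pos _ (sq_nonneg _)).le)
    fun s hs => hψ.posSemidef_gneiting x t hs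

/-! ### The Gamma mixture -/

lemma integral_gamma_mixture {a q ν : ℝ} (ha : 0 < a) (hq : 0 ≤ q) (hν : 0 < ν) :
    ∫ v in Ioi (0 : ℝ), v ^ (ν - 1) * Real.exp (-(a + q) * v) =
      Real.Gamma ν * a⁻¹ ^ ν * (1 + a⁻¹ * q) ^ (-ν) := by
  have h := Real.integral_rpow_mul_exp_neg_mul_Ioi hν (by positivity : 0 < a + q)
  simp only [← neg_mul] at h
  have e : 1 / (a + q) = a⁻¹ * (1 + a⁻¹ * q)⁻¹ := by field_simp
  rw [h, e, Real.mul_rpow (by positivity) (by positivity), Real.inv_rpow (by positivity : 0 ≤ 1 + a⁻¹ * q),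
    Real.rpow_neg (by positivity)]
  ring

lemma norm_inv_sqrt_smul_rpow {V : Type*} [NormedAddCommGroup V] [NormedSpace ℝ V] (h : V) {y : ℝ}
    (hy : 0 < y) (l : ℝ) :
    ‖(y ^ (1 / 2 : ℝ))⁻¹ • h‖ ^ l = (‖h‖ ^ 2 / y) ^ (l / 2) := by
  have e : ‖(y ^ (1 / 2 : ℝ))⁻¹ • h‖ = (‖h‖ ^ 2 / y) ^ (1 / 2 : ℝ) := by
    rw [norm_smul, norm_inv, Real.norm_of_nonneg (by positivity), ← Real.sqrt_eq_rpow,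
      ← Real.sqrt_eq_rpow, Real.sqrt_div (sq_nonneg _), Real.sqrt_sq (norm_nonneg _)]
    ring
  rw [e, ← Real.rpow_mul (by positivity)]
  ring_nf

theorem theorem2 (d p : ℕ) (ψ : ℝ → ℝ) (hψ : PositiveWithCMDeriv ψ)
    (σ r ν : Fin p → ℝ) (hr : ∀ i, 0 < r i) (hν : ∀ i, 0 < ν i)
    (lam : ℝ) (hlam_pos : 0 < lam) (hlam_le : lam ≤ 2)
    (β : Matrix (Fin p) (Fin p) ℝ) (hβ : IsCorrelationMatrix β)
    (r' ν' ρ : Matrix (Fin p) (Fin p) ℝ)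
    (hr' : ∀ i j, r' i j = (((r i)⁻¹ + (r j)⁻¹) / 2)⁻¹)
    (hν' : ∀ i j, ν' i j = (ν i + ν j) / 2)
    (hρ : ∀ i j, ρ i j =
      β i j * (Real.Gamma (ν' i j) /
          (Real.Gamma (ν i) ^ (1 / 2 : ℝ) * Real.Gamma (ν j) ^ (1 / 2 : ℝ))) *
        (r' i j ^ ν' i j / (r i ^ ν i * r j ^ ν j) ^ (1 / 2 : ℝ))) :
    IsMatrixCovariance (gneitingCauchy (d := d) ψ σ ρ r' ν' lam) := by
  intro n s t
  have hψpos : ∀ u : ℝ, 0 < ψ (u ^ 2) := fun u => hψ.pos _ (sq_nonneg _)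
  -- N collects the factors of σ_i σ_j ρ_ij that depend on one index only.
  set N : Fin p → ℝ := fun i => σ i / (Real.Gamma (ν i) ^ (1 / 2 : ℝ) * (r i ^ ν i) ^ (1 / 2 : ℝ))
    with hN
  set q : Fin n → Fin n → ℝ := fun a b =>
    (‖s a - s b‖ ^ 2 / ψ ((t a - t b) ^ 2)) ^ (lam / 2) with hq
  have hq0 : ∀ a b, 0 ≤ q a b := fun a b =>
    Real.rpow_nonneg (div_nonneg (sq_nonneg _) (hψpos _).le) _
  set A : Fin p → Fin p → ℝ := fun i j => ((r i)⁻¹ + (r j)⁻¹) / 2 with hA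
  have hA0 : ∀ i j, 0 < A i j := fun i j => by
    have := inv_pos.2 (hr i); have := inv_pos.2 (hr j); simp only [hA]; positivity
  have hν0 : ∀ i j, 0 < ν' i j := fun i j => by
    rw [hν']; linarith [hν i, hν j]
  set M : ℝ → Matrix (Fin n × Fin p) (Fin n × Fin p) ℝ := fun v => Matrix.of fun x y =>
    β x.2 y.2 * (N x.2 * N y.2) * (ψ ((t x.1 - t y.1) ^ 2) ^ ((d : ℝ) / 2))⁻¹ *
      (v ^ (ν' x.2 y.2 - 1) * Real.exp (-(A x.2 y.2 + q x.1 y.1) * v)) with hM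
  have hint : ∀ x y, Integrable (fun v => M v x y) (volume.restrict (Ioi 0)) := fun x y => by
    have := integrableOn_rpow_mul_exp_neg_mul_rpow (p := 1) (s := ν' x.2 y.2 - 1)
      (b := A x.2 y.2 + q x.1 y.1) (by linarith [hν0 x.2 y.2]) one_pos
      (add_pos_of_pos_of_nonneg (hA0 _ _) (hq0 _ _))
    simp only [Real.rpow_one] at this
    exact this.const_mul _
  have hpsd : ∀ᵐ v ∂volume.restrict (Ioi (0 : ℝ)), (M v).PosSemidef := by
    filter_upwards [ae_restrict_mem measurableSet_Ioi] with v hv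
    have hv : 0 < v := hv
    -- Schur product of β, the rank-one mixing factor and the space-time kernel, pulled back to
    -- pairs.
    have h1 := posSemidef_mul (posSemidef_mul
      (hβ.1.submatrix (Prod.snd : Fin n × Fin p → Fin p)) (posSemidef_mul_self fun x : Fin n × Fin p =>
        N x.2 * (v ^ ((ν x.2 - 1) / 2) * Real.exp (-((r x.2)⁻¹ / 2) * v))))
      ((hψ.posSemidef_gneiting_stable s t hv.le (by positivity : 0 ≤ lam / 2)
        (by linarith)).submatrix (Prod.fst : Fin n × Fin p → Fin n))
    convert h1 using 1
    ext x y
    have e1 : v ^ (ν' x.2 y.2 - 1) = v ^ ((ν x.2 - 1) / 2) * v ^ ((ν y.2 - 1) / 2) := by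
      rw [← Real.rpow_add hv, hν']; ring_nf
    have e2 : Real.exp (-(A x.2 y.2 + q x.1 y.1) * v) = Real.exp (-((r x.2)⁻¹ / 2) * v) *
        Real.exp (-((r y.2)⁻¹ / 2) * v) * Real.exp (-v * q x.1 y.1) := by
      rw [← Real.exp_add, ← Real.exp_add, hA]; ring_nf
    simp only [hM, Matrix.of_apply, Matrix.submatrix_apply]
    rw [e1, e2]
    simp only [hq]
    ring
  convert posSemidef_integral hint hpsd using 1
  ext x y
  simp only [hM, Matrix.of_apply, blockCovMatrix, gneitingCauchy, cauchyFun]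
  rw [integral_const_mul, integral_gamma_mixture (hA0 _ _) (hq0 _ _) (hν0 _ _),
    norm_inv_sqrt_smul_rpow _ (hψpos _), hρ, hr',
    Real.mul_rpow (Real.rpow_nonneg (hr _).le _) (Real.rpow_nonneg (hr _).le _)]
  simp only [hN, hA, hq]
  simp only [div_eq_mul_inv, mul_inv]
  ring
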